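/- Let $\Pi_\ell,\Pi_e\subset\mathbb{R}^2$ be independent homogeneous Poisson point processes (legitimate nodes and non-colluding eavesdroppers) with densities $\lambda_\ell,\lambda_e>0$. Let $P>0$ be the transmit power, $\sigma^2>0$ the common noise power of the legitimate nodes and the eavesdroppers, and $g(r)=r^{-2b}$ with $b>0$ the power gain over distance $r$ (path loss only). Take as typical node a legitimate node placed at the origin, i.e. the node $0$ of $\Pi_\ell\cup\{0\}$. For $i\ge 1$ let $R_{\ell,i}$ be the distance from $0$ to its $i$-th closest neighbour in $\Pi_\ell\cup\{0\}$ and let $R_{e,1}$ be the distance from $0$ to the closest point of $\Pi_e$. The maximum secrecy rate (MSR) between the typical node and its $i$-th closest neighbour is $$\mathcal{R}_{s,i}=\left[\log_2\left(1+\frac{P}{R_{\ell,i}^{2b}\,\sigma^2}\right)-\log_2\left(1+\frac{P}{R_{e,1}^{2b}\,\sigma^2}\right)\right]^+,\qquad [x]^+=\max\{x,0\}.$$ Then $\mathcal{R}_{s,i}$ is a random variable; $R_{\ell,i}^2$ has the Erlang distribution of order $i$ and rate $\pi\lambda_\ell$, and $R_{e,1}^2$ has the exponential distribution of rate $\pi\lambda_e$.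 For every $\varrho\ge 0$ the integral below converges and the cumulative distribution function of $\mathcal{R}_{s,i}$ is $$F_{\mathcal{R}_{s,i}}(\varrho)=1-\frac{\ln 2\,(\pi\lambda_\ell)^i}{(i-1)!\,b}\left(\frac{P}{\sigma^2}\right)^{i/b}\int_\varrho^{\infty}\frac{2^z}{(2^z-1)^{1+\frac ib}}\exp\left(-\pi\lambda_\ell\left(\frac{P/\sigma^2}{2^z-1}\right)^{1/b}-\pi\lambda_e\left(\frac{P/\sigma^2}{2^{z-\varrho}-1}\right)^{1/b}\right)dz .$$ As a corollary, a non-zero MSR exists with probability $$\mathbb{P}\{\mathcal{R}_{s,i}>0\}=\left(\frac{\lambda_\ell}{\lambda_\ell+\lambda_e}\right)^i,$$ and for every $\varrho>0$ the outage probability $\mathbb{P}\{\mathcal{R}_{s,i}<\varrho\}$ equals the right-hand side of the formula for $F_{\mathcal{R}_{s,i}}(\varrho)$ above. -/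

import Mathlib

open MeasureTheory ProbabilityTheory

noncomputable section

/-- The number of points of the configuration `S` in `B` (used for bounded `B` and locally finite
`S`, where it is an honest finite cardinality). -/
def pointCount {d : ℕ} (S B : Set (EuclideanSpace ℝ (Fin d))) : ℕ := (S ∩ B).ncard

/-- The bounded Borel subsets of `ℝᵈ`. -/
def IsBoundedBorel {d : ℕ} (B : Set (EuclideanSpace ℝ (Fin d))) : Prop :=
  MeasurableSet B ∧ Bornology.IsBounded B

/-- A (simple, locally finite) point process in `ℝᵈ`: a random set of points with finitely many
points in each bounded set, whose counts on bounded Borel sets are random variables. -/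
structure IsPointProcess {Ω : Type*} [MeasurableSpace Ω] {d : ℕ}
    (S : Ω → Set (EuclideanSpace ℝ (Fin d))) : Prop where
  locallyFinite : ∀ ω B, Bornology.IsBounded B → (S ω ∩ B).Finite
  measurable_count : ∀ B, IsBoundedBorel B → Measurable fun ω => pointCount (S ω) B

/-- A homogeneous Poisson point process in `ℝᵈ` of density `lam`: the number of points in a bounded
Borel set `B` is Poisson with mean `lam · vol B`, and the numbers of points in finitely many
pairwise disjoint bounded Borel sets are independent. -/
structure IsHomogeneousPoissonProcess {Ω : Type*} [MeasurableSpace Ω] {d : ℕ}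
    (S : Ω → Set (EuclideanSpace ℝ (Fin d))) (lam : ℝ) (μ : Measure Ω) : Prop
    extends IsPointProcess S where
  count_law : ∀ B, IsBoundedBorel B →
    HasLaw (fun ω => pointCount (S ω) B) (poissonMeasure (lam * volume.real B).toNNReal) μ
  count_indep : ∀ (n : ℕ) (B : Fin n → Set (EuclideanSpace ℝ (Fin d))),
    (∀ j, IsBoundedBorel (B j)) → Pairwise (fun j k => Disjoint (B j) (B k)) →
    iIndepFun (fun j ω => pointCount (S ω) (B j)) μ

/-- The σ-algebra on `Ω` generated by a point process, i.e. by all its counts on bounded Borel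
sets. -/
def processSigma {Ω : Type*} {d : ℕ} (S : Ω → Set (EuclideanSpace ℝ (Fin d))) :
    MeasurableSpace Ω :=
  ⨆ B : {B : Set (EuclideanSpace ℝ (Fin d)) // IsBoundedBorel B},
    MeasurableSpace.comap (fun ω => pointCount (S ω) B.1) ⊤

/-- Two point processes are independent if the σ-algebras they generate are. -/
def IndepProcesses {Ω : Type*} [MeasurableSpace Ω] {d : ℕ}
    (S T : Ω → Set (EuclideanSpace ℝ (Fin d))) (μ : Measure Ω) : Prop :=
  Indep (processSigma S) (processSigma T) μ

/-- The distance from the node `x` to its `i`-th closest neighbour in the configuration `S`: the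
least `r ≥ 0` such that at least `i` points of `S` other than `x` lie at distance at most `r`
from `x`. -/
def neighbourDist {d : ℕ} (S : Set (EuclideanSpace ℝ (Fin d))) (x : EuclideanSpace ℝ (Fin d))
    (i : ℕ) : ℝ :=
  sInf {r : ℝ | 0 ≤ r ∧ i ≤ pointCount (S \ {x}) (Metric.closedBall x r)}

/-- The power gain `g(r) = r ^ (-2b)` of the unbounded path-loss model. -/
def pathGain (b r : ℝ) : ℝ := r ^ (-(2 * b))

/-- The maximum secrecy rate (bits per complex dimension) of a Gaussian wiretap link of length `rl`
whose transmitter has transmit power `P` and is at distance `re` from the eavesdropper, with power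
gain `g` and the same noise power `σ ^ 2` at receiver and eavesdropper. -/
def maxSecrecyRate (g : ℝ → ℝ) (P σ rl re : ℝ) : ℝ :=
  max (Real.logb 2 (1 + P * g rl / σ ^ 2) - Real.logb 2 (1 + P * g re / σ ^ 2)) 0

/-- The maximum secrecy rate between the node `x` of the set `L` of legitimate nodes and its `i`-th
closest neighbour in `L`, against the set `E` of non-colluding eavesdroppers: the eavesdropper that
matters is the one closest to the transmitter `x`. -/
def neighbourMSR {d : ℕ} (g : ℝ → ℝ) (P σ : ℝ) (L E : Set (EuclideanSpace ℝ (Fin d)))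
    (x : EuclideanSpace ℝ (Fin d)) (i : ℕ) : ℝ :=
  maxSecrecyRate g P σ (neighbourDist L x i) (Metric.infDist x E)

/-- The integrand, as a function of `z`, in the formula for the distribution function at `ϱ`;
here `c = P / σ ^ 2`. -/
def msrIntegrand (laml lame b c : ℝ) (i : ℕ) (ϱ z : ℝ) : ℝ :=
  (2 : ℝ) ^ z / ((2 : ℝ) ^ z - 1) ^ (1 + (i : ℝ) / b) *
    Real.exp (-(Real.pi * laml * (c / ((2 : ℝ) ^ z - 1)) ^ (1 / b))
      - Real.pi * lame * (c / ((2 : ℝ) ^ (z - ϱ) - 1)) ^ (1 / b))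

/-- The explicit formula for the distribution function at `ϱ`; here `c = P / σ ^ 2`. -/
def msrCDFFormula (laml lame b c : ℝ) (i : ℕ) (ϱ : ℝ) : ℝ :=
  1 - Real.log 2 * (Real.pi * laml) ^ i / ((Nat.factorial (i - 1) : ℝ) * b) * c ^ ((i : ℝ) / b) *
    ∫ z in Set.Ioi ϱ, msrIntegrand laml lame b c i ϱ z

end

/-! The secrecy rate depends on the two configurations only through the squared distances X to the
`i`-th neighbour and Y to the nearest eavesdropper. Each distance is the first radius at which a
Poisson count reaches a level, so X² type events such as {X ≤ t²} are, up to null sets, Poisson tail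
events; this gives the Erlang and exponential laws (`hasLaw_sInf_count_sq`). Each distance is
measurable for the σ-algebra of its own process, so X and Y are independent and their joint law is a
product.

Now parametrize squared length by capacity z through the decreasing bijection `sqLengthOfCapacity`
of (0,∞). If X has capacity z and Y has capacity w, the unclipped rate is z - w, so it exceeds ϱ
exactly when z > ϱ and Y is greater than the squared length of capacity z - ϱ. Given z, the latter
has an explicit exponential probability; integrating it against the Erlang law in the variable z
yields the formula (`prod_gammaMeasure_expMeasure_eq_lintegral`). For ϱ = 0 the event is X < Y, and
the integral is evaluated directly in the variable x. -/

/-! ### Erlang distribution functions and Poisson tails. -/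

lemma hasDerivAt_exp_neg_mul_sum_range (α : ℝ) (n : ℕ) (x : ℝ) :
    HasDerivAt (fun x => ∑ k ∈ Finset.range (n + 1),
        Real.exp (-(α * x)) * (α * x) ^ k / (Nat.factorial k : ℝ))
      (-(α ^ (n + 1) / (Nat.factorial n : ℝ) * x ^ n * Real.exp (-(α * x)))) x := by
  have hexp : HasDerivAt (fun x => Real.exp (-(α * x))) (Real.exp (-(α * x)) * -(α * 1)) x :=
    (((hasDerivAt_id x).const_mul α).neg).exp
  induction n with
  | zero =>
    simp only [zero_add, Finset.sum_range_one, pow_zero, Nat.factorial_zero, Nat.cast_one, div_one,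
      mul_one, pow_one]
    convert hexp using 1
    ring
  | succ n ih =>
    simp_rw [Finset.sum_range_succ _ (n + 1)]
    have hpow : HasDerivAt (fun x => (α * x) ^ (n + 1))
        (((n + 1 : ℕ) : ℝ) * (α * x) ^ n * (α * 1)) x := by
      simpa using ((hasDerivAt_id x).const_mul α).fun_pow (n + 1)
    have hf : (Nat.factorial n : ℝ) ≠ 0 := by positivity
    refine (ih.fun_add ((hexp.fun_mul hpow).div_const (Nat.factorial (n + 1) : ℝ))).congr_deriv ?_
    rw [Nat.factorial_succ]
    push_cast
    field_simp
    ring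

lemma poissonMeasure_real_Ici (r : NNReal) (n : ℕ) :
    (poissonMeasure r).real (Set.Ici n) =
      1 - ∑ k ∈ Finset.range n, Real.exp (-r) * (r : ℝ) ^ k / (Nat.factorial k : ℝ) := by
  have h : Set.Ici n = (↑(Finset.range n) : Set ℕ)ᶜ := by ext; simp
  rw [h, probReal_compl_eq_one_sub (Finset.measurableSet _), ← sum_measureReal_singleton]
  simp_rw [poissonMeasure_real_singleton]

/-- The distribution function of an Erlang distribution is a Poisson tail. -/
lemma cdf_gammaMeasure_natCast {α : ℝ} (hα : 0 < α) {i : ℕ} (hi : 1 ≤ i) {t : ℝ} (ht : 0 ≤ t) :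
    cdf (gammaMeasure i α) t = (poissonMeasure (α * t).toNNReal).real (Set.Ici i) := by
  obtain ⟨n, rfl⟩ : ∃ n, i = n + 1 := ⟨i - 1, by omega⟩
  rw [cdf_gammaMeasure_eq_integral (by positivity) hα, poissonMeasure_real_Ici,
    Real.coe_toNNReal _ (by positivity),
    setIntegral_eq_of_subset_of_forall_sdiff_eq_zero measurableSet_Iic
      (Set.Icc_subset_Iic_self : Set.Icc 0 t ⊆ _)]
  · have hcongr : ∫ x in Set.Icc 0 t, gammaPDFReal ((n + 1 : ℕ) : ℝ) α x =
        ∫ x in Set.Icc 0 t, α ^ (n + 1) / (Nat.factorial n : ℝ) * x ^ n * Real.exp (-(α * x)) := by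
      refine setIntegral_congr_fun measurableSet_Icc fun x hx => ?_
      simp only [gammaPDFReal, if_pos hx.1, Real.rpow_natCast]
      push_cast
      rw [Real.Gamma_nat_eq_factorial, add_sub_cancel_right, Real.rpow_natCast]
    -- The antiderivative is minus the Poisson partial sum: differentiating that sum term by term
    -- telescopes, and only its last term survives.
    rw [hcongr, integral_Icc_eq_integral_Ioc, ← intervalIntegral.integral_of_le ht,
      intervalIntegral.integral_eq_sub_of_hasDerivAt
        (fun x _ => by simpa using (hasDerivAt_exp_neg_mul_sum_range α n x).neg)
        (Continuous.intervalIntegrable (by fun_prop) _ _)]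
    simp [Finset.sum_range_succ']
    ring
  · intro x hx
    have : ¬ 0 ≤ x := fun h => hx.2 ⟨h, hx.1⟩
    simp [gammaPDFReal, this]

lemma cdf_gammaMeasure_of_neg {a r : ℝ} (ha : 0 < a) (hr : 0 < r) {x : ℝ} (hx : x < 0) :
    cdf (gammaMeasure a r) x = 0 := by
  rw [cdf_gammaMeasure_eq_integral ha hr]
  refine setIntegral_eq_zero_of_forall_eq_zero fun y (hy : y ≤ x) => ?_
  simp [gammaPDFReal, (hy.trans_lt hx).not_ge]

/-! ### First-passage radii of monotone counts. -/

/-- The first radius at which a counting function reaches level `i` is measurable. -/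
lemma measurable_sInf_count {Ω : Type*} [MeasurableSpace Ω] {N : ℝ → Ω → ℕ}
    (hN : ∀ r, Measurable (N r)) (hmono : ∀ ω, Monotone fun r => N r ω) (i : ℕ) :
    Measurable fun ω => sInf {r : ℝ | 0 ≤ r ∧ i ≤ N r ω} := by
  refine measurable_of_Iio fun t => ?_
  have hbdd (ω : Ω) : BddBelow {r : ℝ | 0 ≤ r ∧ i ≤ N r ω} := ⟨0, fun r hr => hr.1⟩
  rcases le_or_gt t 0 with ht | ht
  · convert MeasurableSet.empty
    ext ω
    simpa using ht.trans (Real.sInf_nonneg fun r hr => hr.1)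
  -- The second set collects the ω for which level `i` is never reached: there the infimum is `sInf
  -- ∅ = 0`, which is below `t`.
  · have hset : (fun ω => sInf {r : ℝ | 0 ≤ r ∧ i ≤ N r ω}) ⁻¹' Set.Iio t =
        (⋃ q : ℚ, ⋃ _ : 0 ≤ (q : ℝ) ∧ (q : ℝ) < t, {ω | i ≤ N q ω}) ∪
          ⋂ n : ℕ, {ω | N n ω < i} := by
      ext ω
      simp only [Set.mem_preimage, Set.mem_Iio, Set.mem_union, Set.mem_iUnion, Set.mem_iInter,
        Set.mem_ofPred_eq, exists_prop]
      constructor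
      · intro h
        by_cases hne : {r : ℝ | 0 ≤ r ∧ i ≤ N r ω}.Nonempty
        · obtain ⟨s, ⟨hs0, hs⟩, hst⟩ := exists_lt_of_csInf_lt hne h
          obtain ⟨q, hsq, hqt⟩ := exists_rat_btwn hst
          exact Or.inl ⟨q, ⟨hs0.trans hsq.le, hqt⟩, hs.trans (hmono ω hsq.le)⟩
        · refine Or.inr fun n => ?_
          by_contra hn
          exact hne ⟨n, n.cast_nonneg, not_lt.1 hn⟩
      · rintro (⟨q, ⟨hq0, hqt⟩, hq⟩ | h)
        · exact (csInf_le (hbdd ω) ⟨hq0, hq⟩).trans_lt hqt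
        · have : {r : ℝ | 0 ≤ r ∧ i ≤ N r ω} = ∅ := by
            refine Set.eq_empty_of_forall_notMem fun r hr => ?_
            obtain ⟨n, hn⟩ := exists_nat_ge r
            exact (hr.2.trans (hmono ω hn)).not_gt (h n)
          rw [this, Real.sInf_empty]
          exact ht
    rw [hset]
    refine MeasurableSet.union (.iUnion fun q => .iUnion fun _ => ?_) (.iInter fun n => ?_)
    · exact hN q measurableSet_Ici
    · exact hN n measurableSet_Iio

/-- If the number of points within distance `t` is Poisson with mean `α * t ^ 2`, then the squared
distance to the `i`-th point has the Erlang distribution of order `i` and rate `α`. -/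
lemma hasLaw_sInf_count_sq {Ω : Type*} [MeasurableSpace Ω] {μ : Measure Ω} [IsProbabilityMeasure μ]
    {N : ℝ → Ω → ℕ} (hN : ∀ r, Measurable (N r)) (hmono : ∀ ω, Monotone fun r => N r ω)
    {α : ℝ} (hα : 0 < α)
    (hlaw : ∀ t, 0 ≤ t → HasLaw (N t) (poissonMeasure (α * t ^ 2).toNNReal) μ)
    {i : ℕ} (hi : 1 ≤ i) :
    HasLaw (fun ω => sInf {r : ℝ | 0 ≤ r ∧ i ≤ N r ω} ^ 2) (gammaMeasure i α) μ := by
  have hi0 : (0 : ℝ) < i := by exact_mod_cast hi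
  have := isProbabilityMeasure_gammaMeasure hi0 hα
  set R : Ω → ℝ := fun ω => sInf {r : ℝ | 0 ≤ r ∧ i ≤ N r ω} with hR
  have hRm : Measurable R := measurable_sInf_count hN hmono i
  have hR0 (ω : Ω) : 0 ≤ R ω := Real.sInf_nonneg fun r hr => hr.1
  have hbdd (ω : Ω) : BddBelow {r : ℝ | 0 ≤ r ∧ i ≤ N r ω} := ⟨0, fun r hr => hr.1⟩
  have hcount {t : ℝ} (ht : 0 ≤ t) :
      μ.real {ω | i ≤ N t ω} = cdf (gammaMeasure i α) (t ^ 2) := by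
    rw [cdf_gammaMeasure_natCast hα hi (sq_nonneg t)]
    exact (hlaw t ht).measureReal_eq (p := fun k => i ≤ k) measurableSet_Ici
  -- Where level `i` is never reached, `R` takes the default value 0 and would spoil the law. This
  -- is a null event because the distribution function tends to 1.
  have hex : ∀ᵐ ω ∂μ, ∃ n : ℕ, i ≤ N n ω := by
    rw [ae_iff]
    refine (measureReal_eq_zero_iff (by finiteness)).1 (le_antisymm ?_ measureReal_nonneg)
    have hlim : Filter.Tendsto (fun n : ℕ => 1 - cdf (gammaMeasure i α) ((n : ℝ) ^ 2))
        Filter.atTop (nhds (1 - 1)) :=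
      tendsto_const_nhds.sub ((tendsto_cdf_atTop _).comp
        ((Filter.tendsto_pow_atTop two_ne_zero).comp tendsto_natCast_atTop_atTop))
    rw [sub_self] at hlim
    refine ge_of_tendsto' hlim fun n => ?_
    have hmeas : MeasurableSet {ω | i ≤ N n ω} := hN n measurableSet_Ici
    rw [← hcount n.cast_nonneg, ← probReal_compl_eq_one_sub hmeas]
    exact measureReal_mono fun ω hω h => hω ⟨n, h⟩
  change HasLaw (fun ω => R ω ^ 2) _ _
  have : IsProbabilityMeasure (μ.map fun ω => R ω ^ 2) :=
    Measure.isProbabilityMeasure_map (by fun_prop)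
  refine ⟨by fun_prop, Measure.eq_of_cdf _ _ ?_⟩
  ext x
  rw [cdf_eq_real, map_measureReal_apply (by fun_prop) measurableSet_Iic]
  rcases lt_or_ge x 0 with hx | hx
  · rw [cdf_gammaMeasure_of_neg hi0 hα hx]
    convert measureReal_empty
    ext ω
    simpa using hx.trans_le (sq_nonneg _)
  refine le_antisymm ?_ ?_
  -- The infimum is not known to be attained, so `R ω ≤ √x` only gives a count of at least `i` at
  -- each radius `√y` with `y > x`; right continuity then lets `y` decrease to `x`.
  · have hlim := (cdf (gammaMeasure i α)).right_continuous x
    have hlim' : Filter.Tendsto (cdf (gammaMeasure i α)) (nhdsWithin x (Set.Ioi x))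
        (nhds (cdf (gammaMeasure i α) x)) :=
      hlim.tendsto.mono_left (nhdsWithin_mono _ Set.Ioi_subset_Ici_self)
    refine ge_of_tendsto hlim' ?_
    filter_upwards [self_mem_nhdsWithin] with y (hy : x < y)
    have hy0 : 0 ≤ y := hx.trans hy.le
    rw [← Real.sq_sqrt hy0, ← hcount (Real.sqrt_nonneg y)]
    refine ENNReal.toReal_mono (by finiteness) (measure_mono_ae ?_)
    filter_upwards [hex] with ω ⟨n, hn⟩ hω
    have hlt : R ω < √y := Real.lt_sqrt_of_sq_lt (lt_of_le_of_lt hω hy)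
    have hne : {r : ℝ | 0 ≤ r ∧ i ≤ N r ω}.Nonempty := ⟨(n : ℝ), n.cast_nonneg, hn⟩
    obtain ⟨s, ⟨-, hs⟩, hst⟩ := exists_lt_of_csInf_lt hne hlt
    exact hs.trans (hmono ω hst.le)
  · nth_rewrite 1 [← Real.sq_sqrt hx]
    rw [← hcount (Real.sqrt_nonneg x)]
    refine measureReal_mono fun ω hω => ?_
    have : R ω ≤ √x := csInf_le (hbdd ω) ⟨Real.sqrt_nonneg x, hω⟩
    exact (Real.le_sqrt (hR0 ω) hx).1 this

/-! ### Distances in a configuration as first-passage radii. -/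

section Distances

variable {d : ℕ} {S : Set (EuclideanSpace ℝ (Fin d))}

lemma isBoundedBorel_closedBall (x : EuclideanSpace ℝ (Fin d)) (r : ℝ) :
    IsBoundedBorel (Metric.closedBall x r) :=
  ⟨measurableSet_closedBall, Metric.isBounded_closedBall⟩

lemma isBoundedBorel_closedBall_diff_singleton (x : EuclideanSpace ℝ (Fin d)) (r : ℝ) :
    IsBoundedBorel (Metric.closedBall x r \ {x}) :=
  ⟨measurableSet_closedBall.diff (measurableSet_singleton x),
    Metric.isBounded_closedBall.subset Set.sdiff_subset⟩

lemma pointCount_mono {B C : Set (EuclideanSpace ℝ (Fin d))}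
    (hS : ∀ B, Bornology.IsBounded B → (S ∩ B).Finite) (hC : Bornology.IsBounded C) (h : B ⊆ C) :
    pointCount S B ≤ pointCount S C :=
  Set.ncard_le_ncard (Set.inter_subset_inter_right S h) (hS C hC)

/-- Moving the removal of `x` from the configuration to the test set leaves a count of `S` itself on
a bounded Borel set. -/
lemma neighbourDist_insert_self (S : Set (EuclideanSpace ℝ (Fin d)))
    (x : EuclideanSpace ℝ (Fin d)) (i : ℕ) :
    neighbourDist (insert x S) x i =
      sInf {r : ℝ | 0 ≤ r ∧ i ≤ pointCount S (Metric.closedBall x r \ {x})} := by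
  have h (r : ℝ) : pointCount (insert x S \ {x}) (Metric.closedBall x r) =
      pointCount S (Metric.closedBall x r \ {x}) := by
    unfold pointCount
    congr 1
    ext y
    simp only [Set.mem_inter_iff, Set.mem_sdiff, Set.mem_insert_iff, Set.mem_singleton_iff]
    tauto
  simp_rw [neighbourDist, h]

/-- For empty `S` both sides equal 0 by convention. -/
lemma infDist_eq_sInf_count (hS : ∀ B, Bornology.IsBounded B → (S ∩ B).Finite)
    (x : EuclideanSpace ℝ (Fin d)) :
    Metric.infDist x S = sInf {r : ℝ | 0 ≤ r ∧ 1 ≤ pointCount S (Metric.closedBall x r)} := by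
  have hiff (r : ℝ) : 1 ≤ pointCount S (Metric.closedBall x r) ↔ ∃ y ∈ S, dist x y ≤ r := by
    rw [pointCount, Nat.one_le_iff_ne_zero, ← Nat.pos_iff_ne_zero,
      Set.ncard_pos (hS _ Metric.isBounded_closedBall)]
    simp [Set.Nonempty, dist_comm x]
  simp_rw [hiff]
  have hbdd : BddBelow {r : ℝ | 0 ≤ r ∧ ∃ y ∈ S, dist x y ≤ r} := ⟨0, fun r hr => hr.1⟩
  rcases S.eq_empty_or_nonempty with rfl | hne
  · simp
  refine le_antisymm (le_csInf ?_ ?_) ((Metric.le_infDist hne).2 fun {y} hy => ?_)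
  · obtain ⟨y, hy⟩ := hne
    exact ⟨dist x y, dist_nonneg, y, hy, le_rfl⟩
  · rintro r ⟨-, y, hy, hr⟩
    exact (Metric.infDist_le_dist_of_mem hy).trans hr
  · exact csInf_le hbdd ⟨dist_nonneg, y, hy, le_rfl⟩

end Distances

/-! ### Measurability for the σ-algebra generated by a process. -/

section Processes

variable {Ω : Type*} {d : ℕ} {S : Ω → Set (EuclideanSpace ℝ (Fin d))}

lemma measurable_pointCount_processSigma {B : Set (EuclideanSpace ℝ (Fin d))}
    (hB : IsBoundedBorel B) : Measurable[processSigma S] fun ω => pointCount (S ω) B := by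
  refine Measurable.mono (comap_measurable _) ?_ le_rfl
  exact le_iSup (fun B : {B : Set (EuclideanSpace ℝ (Fin d)) // IsBoundedBorel B} =>
    MeasurableSpace.comap (fun ω => pointCount (S ω) B.1) ⊤) ⟨B, hB⟩

/-- Measurability for the generated σ-algebra, not just the ambient one, is what transfers
independence of the processes to the distances. -/
lemma measurable_neighbourDist_processSigma
    (hS : ∀ ω B, Bornology.IsBounded B → (S ω ∩ B).Finite) (x : EuclideanSpace ℝ (Fin d)) (i : ℕ) :
    Measurable[processSigma S] fun ω => neighbourDist (insert x (S ω)) x i := by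
  simp_rw [neighbourDist_insert_self]
  let _ := processSigma S
  refine measurable_sInf_count (N := fun r ω => pointCount (S ω) (Metric.closedBall x r \ {x}))
    (fun r => measurable_pointCount_processSigma (isBoundedBorel_closedBall_diff_singleton x r))
    (fun ω r s hrs => ?_) i
  exact pointCount_mono (hS ω) (isBoundedBorel_closedBall_diff_singleton x s).2
    (Set.sdiff_subset_sdiff_left (Metric.closedBall_subset_closedBall hrs))

lemma measurable_infDist_processSigma
    (hS : ∀ ω B, Bornology.IsBounded B → (S ω ∩ B).Finite) (x : EuclideanSpace ℝ (Fin d)) :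
    Measurable[processSigma S] fun ω => Metric.infDist x (S ω) := by
  simp_rw [fun ω => infDist_eq_sInf_count (hS ω) x]
  let _ := processSigma S
  refine measurable_sInf_count (N := fun r ω => pointCount (S ω) (Metric.closedBall x r))
    (fun r => measurable_pointCount_processSigma (isBoundedBorel_closedBall x r))
    (fun ω r s hrs => ?_) 1
  exact pointCount_mono (hS ω) Metric.isBounded_closedBall
    (Metric.closedBall_subset_closedBall hrs)

variable [MeasurableSpace Ω]

lemma IsPointProcess.processSigma_le (hS : IsPointProcess S) :
    processSigma S ≤ ‹MeasurableSpace Ω› :=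
  iSup_le fun B => (hS.measurable_count B.1 B.2).comap_le

end Processes

/-! ### Laws of the squared distances in the plane. -/

section Laws

variable {Ω : Type*} [MeasurableSpace Ω] {μ : Measure Ω} [IsProbabilityMeasure μ]
  {S : Ω → Set (EuclideanSpace ℝ (Fin 2))} {lam : ℝ}

lemma volume_real_closedBall_fin_two (x : EuclideanSpace ℝ (Fin 2)) {r : ℝ} (hr : 0 ≤ r) :
    volume.real (Metric.closedBall x r) = Real.pi * r ^ 2 := by
  rw [measureReal_def, EuclideanSpace.volume_closedBall_fin_two, ← ENNReal.ofReal_pow hr,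
    ← ENNReal.ofReal_mul (by positivity), ENNReal.toReal_ofReal (by positivity), mul_comm]

lemma IsHomogeneousPoissonProcess.hasLaw_neighbourDist_sq
    (hS : IsHomogeneousPoissonProcess S lam μ) (hlam : 0 < lam) (x : EuclideanSpace ℝ (Fin 2))
    {i : ℕ} (hi : 1 ≤ i) :
    HasLaw (fun ω => neighbourDist (insert x (S ω)) x i ^ 2) (gammaMeasure i (Real.pi * lam)) μ := by
  simp_rw [neighbourDist_insert_self]
  refine hasLaw_sInf_count_sq (N := fun r ω => pointCount (S ω) (Metric.closedBall x r \ {x}))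
    (fun r => hS.measurable_count _ (isBoundedBorel_closedBall_diff_singleton x r))
    (fun ω r s hrs => ?_) (by positivity) (fun t ht => ?_) hi
  · exact pointCount_mono (hS.locallyFinite ω) (isBoundedBorel_closedBall_diff_singleton x s).2
      (Set.sdiff_subset_sdiff_left (Metric.closedBall_subset_closedBall hrs))
  · convert hS.count_law _ (isBoundedBorel_closedBall_diff_singleton x t) using 3
    rw [measureReal_congr (sdiff_null_ae_eq_self (measure_singleton x)),
      volume_real_closedBall_fin_two x ht]
    ring

lemma IsHomogeneousPoissonProcess.hasLaw_infDist_sq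
    (hS : IsHomogeneousPoissonProcess S lam μ) (hlam : 0 < lam) (x : EuclideanSpace ℝ (Fin 2)) :
    HasLaw (fun ω => Metric.infDist x (S ω) ^ 2) (expMeasure (Real.pi * lam)) μ := by
  simp_rw [fun ω => infDist_eq_sInf_count (hS.locallyFinite ω) x]
  have h := hasLaw_sInf_count_sq (N := fun r ω => pointCount (S ω) (Metric.closedBall x r))
    (μ := μ) (α := Real.pi * lam) (i := 1)
    (fun r => hS.measurable_count _ (isBoundedBorel_closedBall x r))
    (fun ω r s hrs => ?_) (by positivity) (fun t ht => ?_) le_rfl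
  · rwa [Nat.cast_one] at h
  · exact pointCount_mono (hS.locallyFinite ω) Metric.isBounded_closedBall
      (Metric.closedBall_subset_closedBall hrs)
  · convert hS.count_law _ (isBoundedBorel_closedBall x t) using 3
    rw [volume_real_closedBall_fin_two x ht]
    ring

end Laws

/-! ### Capacity as a coordinate on squared lengths. -/

noncomputable section

/-- The difference of the capacities of two links with squared lengths `x` and `y`, path-loss
exponent `2 * b` and transmit signal-to-noise ratio `c`. -/
def capacityGap (c b x y : ℝ) : ℝ :=
  Real.logb 2 (1 + c * x ^ (-b)) - Real.logb 2 (1 + c * y ^ (-b))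

/-- The squared length of the link whose capacity is `z`. -/
def sqLengthOfCapacity (c b z : ℝ) : ℝ := (c / ((2 : ℝ) ^ z - 1)) ^ (1 / b)

end

section SqLength

variable {c b : ℝ}

lemma two_rpow_sub_one_pos {z : ℝ} (hz : 0 < z) : 0 < (2 : ℝ) ^ z - 1 :=
  sub_pos.2 (Real.one_lt_rpow one_lt_two hz)

lemma sqLengthOfCapacity_pos (hc : 0 < c) {z : ℝ} (hz : 0 < z) : 0 < sqLengthOfCapacity c b z :=
  Real.rpow_pos_of_pos (div_pos hc (two_rpow_sub_one_pos hz)) _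

lemma logb_capacity_sqLengthOfCapacity (hc : 0 < c) (hb : 0 < b) {z : ℝ} (hz : 0 < z) :
    Real.logb 2 (1 + c * sqLengthOfCapacity c b z ^ (-b)) = z := by
  have h := two_rpow_sub_one_pos hz
  have h1 : sqLengthOfCapacity c b z ^ (-b) = ((2 : ℝ) ^ z - 1) / c := by
    rw [sqLengthOfCapacity, ← Real.rpow_mul (div_pos hc h).le]
    have : 1 / b * -b = -1 := by field_simp
    rw [this, Real.rpow_neg_one, inv_div]
  rw [h1, mul_div_cancel₀ _ hc.ne', add_sub_cancel, Real.logb_rpow two_pos one_lt_two.ne']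

lemma exists_sqLengthOfCapacity_eq (hc : 0 < c) (hb : 0 < b) {x : ℝ} (hx : 0 < x) :
    ∃ z, 0 < z ∧ sqLengthOfCapacity c b z = x := by
  have hpos : 0 < c * x ^ (-b) := mul_pos hc (Real.rpow_pos_of_pos hx _)
  refine ⟨Real.logb 2 (1 + c * x ^ (-b)), Real.logb_pos one_lt_two (by linarith), ?_⟩
  rw [sqLengthOfCapacity, Real.rpow_logb two_pos one_lt_two.ne' (by linarith), add_sub_cancel_left,
    Real.rpow_neg hx.le, div_mul_cancel_left₀ hc.ne', inv_inv, ← Real.rpow_mul hx.le,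
    mul_one_div_cancel hb.ne', Real.rpow_one]

lemma sqLengthOfCapacity_strictAntiOn (hc : 0 < c) (hb : 0 < b) :
    StrictAntiOn (sqLengthOfCapacity c b) (Set.Ioi 0) := by
  intro z hz w hw hzw
  have hz' := two_rpow_sub_one_pos hz
  have hw' := two_rpow_sub_one_pos hw
  refine Real.rpow_lt_rpow (div_pos hc hw').le ?_ (by positivity)
  exact div_lt_div_of_pos_left hc hz'
    (sub_lt_sub_right (Real.rpow_lt_rpow_of_exponent_lt one_lt_two hzw) 1)

lemma image_sqLengthOfCapacity (hc : 0 < c) (hb : 0 < b) :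
    sqLengthOfCapacity c b '' Set.Ioi 0 = Set.Ioi 0 := by
  ext x
  constructor
  · rintro ⟨z, hz, rfl⟩
    exact sqLengthOfCapacity_pos hc hz
  · intro hx
    obtain ⟨z, hz, h⟩ := exists_sqLengthOfCapacity_eq hc hb hx
    exact ⟨z, hz, h⟩

lemma hasDerivAt_sqLengthOfCapacity (hc : 0 < c) {z : ℝ} (hz : 0 < z) :
    HasDerivAt (sqLengthOfCapacity c b)
      (-(Real.log 2 / b * (2 : ℝ) ^ z / ((2 : ℝ) ^ z - 1) * sqLengthOfCapacity c b z)) z := by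
  have h := two_rpow_sub_one_pos hz
  have hpow : HasDerivAt (fun z : ℝ => (2 : ℝ) ^ z - 1) ((2 : ℝ) ^ z * Real.log 2) z :=
    ((Real.hasStrictDerivAt_const_rpow two_pos z).hasDerivAt).sub_const 1
  have hdiv := ((hasDerivAt_const z c).fun_div hpow h.ne').rpow_const (p := 1 / b)
    (Or.inl (div_pos hc h).ne')
  refine hdiv.congr_deriv ?_
  rw [sqLengthOfCapacity, Real.rpow_sub_one (div_pos hc h).ne']
  field_simp
  ring

/-- Write `y` as the squared length of capacity `w > 0`: the gap is `z - w`, and squared length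
decreases with capacity. Positivity of `w` forces `ϱ < z`, which also keeps `z - ϱ` in the range
where `sqLengthOfCapacity` is meaningful. -/
lemma lt_capacityGap_sqLengthOfCapacity_iff (hc : 0 < c) (hb : 0 < b) {z y ϱ : ℝ} (hz : 0 < z)
    (hy : 0 < y) :
    ϱ < capacityGap c b (sqLengthOfCapacity c b z) y ↔
      ϱ < z ∧ sqLengthOfCapacity c b (z - ϱ) < y := by
  obtain ⟨w, hw, rfl⟩ := exists_sqLengthOfCapacity_eq hc hb hy
  rw [capacityGap, logb_capacity_sqLengthOfCapacity hc hb hz,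
    logb_capacity_sqLengthOfCapacity hc hb hw]
  constructor
  · intro h
    have h0 : 0 < z - ϱ := by linarith
    exact ⟨by linarith, (sqLengthOfCapacity_strictAntiOn hc hb).lt_iff_gt h0 hw |>.2 (by linarith)⟩
  · rintro ⟨h1, h2⟩
    linarith [((sqLengthOfCapacity_strictAntiOn hc hb).lt_iff_gt
      (show z - ϱ ∈ Set.Ioi 0 from sub_pos.2 h1) hw).1 h2]

/-- The bound `ϱ < z` stays strict here, again because `w > 0`. -/
lemma le_capacityGap_sqLengthOfCapacity_iff (hc : 0 < c) (hb : 0 < b) {z y ϱ : ℝ} (hz : 0 < z)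
    (hy : 0 < y) :
    ϱ ≤ capacityGap c b (sqLengthOfCapacity c b z) y ↔
      ϱ < z ∧ sqLengthOfCapacity c b (z - ϱ) ≤ y := by
  obtain ⟨w, hw, rfl⟩ := exists_sqLengthOfCapacity_eq hc hb hy
  rw [capacityGap, logb_capacity_sqLengthOfCapacity hc hb hz,
    logb_capacity_sqLengthOfCapacity hc hb hw]
  constructor
  · intro h
    have h0 : 0 < z - ϱ := by linarith
    exact ⟨by linarith, (sqLengthOfCapacity_strictAntiOn hc hb).le_iff_ge h0 hw |>.2 (by linarith)⟩
  · rintro ⟨h1, h2⟩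
    linarith [((sqLengthOfCapacity_strictAntiOn hc hb).le_iff_ge
      (show z - ϱ ∈ Set.Ioi 0 from sub_pos.2 h1) hw).1 h2]

lemma measurable_capacityGap (c b : ℝ) :
    Measurable fun p : ℝ × ℝ => capacityGap c b p.1 p.2 := by
  unfold capacityGap Real.logb
  fun_prop

/-- Change of variables along the decreasing bijection of (0,∞); the factor before the density is
the absolute value of its derivative. -/
lemma lintegral_gammaMeasure_eq_lintegral_sqLength {a r : ℝ} (hc : 0 < c) (hb : 0 < b)
    {F : ℝ → ENNReal} (hF : Measurable F) :
    ∫⁻ x, F x ∂gammaMeasure a r = ∫⁻ z in Set.Ioi 0,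
      ENNReal.ofReal (Real.log 2 / b * (2 : ℝ) ^ z / ((2 : ℝ) ^ z - 1) * sqLengthOfCapacity c b z *
        gammaPDFReal a r (sqLengthOfCapacity c b z)) * F (sqLengthOfCapacity c b z) := by
  have hpdf : Measurable (gammaPDF a r) := (measurable_gammaPDFReal a r).ennreal_ofReal
  rw [gammaMeasure, lintegral_withDensity_eq_lintegral_mul _ hpdf hF]
  have h0 : ∫⁻ x, (gammaPDF a r * F) x = ∫⁻ x in Set.Ioi 0, (gammaPDF a r * F) x := by
    rw [setLIntegral_congr Ioi_ae_eq_Ici]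
    refine (setLIntegral_eq_of_support_subset fun x hx => ?_).symm
    by_contra hx'
    exact hx (by simp [gammaPDF_of_neg (not_le.1 hx')])
  rw [h0]
  nth_rewrite 1 [← image_sqLengthOfCapacity hc hb]
  rw [lintegral_image_eq_lintegral_abs_deriv_mul measurableSet_Ioi
    (fun z hz => (hasDerivAt_sqLengthOfCapacity hc hz).hasDerivWithinAt)
    (sqLengthOfCapacity_strictAntiOn hc hb).injOn]
  refine setLIntegral_congr_fun measurableSet_Ioi fun z (hz : 0 < z) => ?_
  have hl := sqLengthOfCapacity_pos (b := b) hc hz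
  have h := two_rpow_sub_one_pos hz
  have hlog : 0 < Real.log 2 := Real.log_pos one_lt_two
  have hnn : 0 ≤ Real.log 2 / b * (2 : ℝ) ^ z / ((2 : ℝ) ^ z - 1) * sqLengthOfCapacity c b z := by
    positivity
  simp only [Pi.mul_apply, abs_neg, abs_of_nonneg hnn]
  rw [ENNReal.ofReal_mul hnn, gammaPDF, mul_assoc]

end SqLength

/-! ### Exponential tails. -/

section Exponential

lemma gammaMeasure_absolutelyContinuous (a r : ℝ) : gammaMeasure a r ≪ volume :=
  withDensity_absolutelyContinuous _ _

lemma expMeasure_Iic_zero {r : ℝ} (hr : 0 < r) : expMeasure r (Set.Iic 0) = 0 := by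
  have := isProbabilityMeasure_expMeasure hr
  rw [← ofReal_cdf, cdf_expMeasure_eq hr]
  simp

lemma expMeasure_Ioi {r : ℝ} (hr : 0 < r) {t : ℝ} (ht : 0 ≤ t) :
    expMeasure r (Set.Ioi t) = ENNReal.ofReal (Real.exp (-(r * t))) := by
  have := isProbabilityMeasure_expMeasure hr
  rw [← Set.compl_Iic, ← ofReal_measureReal, probReal_compl_eq_one_sub measurableSet_Iic,
    ← cdf_eq_real, cdf_expMeasure_eq hr, if_pos ht, sub_sub_cancel]

lemma expMeasure_Ici {r : ℝ} (hr : 0 < r) {t : ℝ} (ht : 0 ≤ t) :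
    expMeasure r (Set.Ici t) = ENNReal.ofReal (Real.exp (-(r * t))) := by
  rw [← expMeasure_Ioi hr ht]
  exact measure_congr ((gammaMeasure_absolutelyContinuous 1 r).ae_le Ioi_ae_eq_Ici.symm)

/-- Between the open and the closed upper ray, every set of positive numbers has the same
exponential probability. -/
lemma expMeasure_eq_of_Ioi_subset {r : ℝ} (hr : 0 < r) {t : ℝ} (ht : 0 ≤ t) {s : Set ℝ}
    (h1 : Set.Ioi t ⊆ s) (h2 : ∀ y ∈ s, 0 < y → t ≤ y) :
    expMeasure r s = ENNReal.ofReal (Real.exp (-(r * t))) := by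
  refine le_antisymm ?_ ((expMeasure_Ioi hr ht).ge.trans (measure_mono h1))
  calc expMeasure r s ≤ expMeasure r (Set.Iic 0 ∪ Set.Ici t) :=
        measure_mono fun y hy => (le_or_gt y 0).imp id (h2 y hy)
    _ ≤ expMeasure r (Set.Iic 0) + expMeasure r (Set.Ici t) := measure_union_le _ _
    _ = _ := by rw [expMeasure_Iic_zero hr, zero_add, expMeasure_Ici hr ht]

end Exponential

/-! ### The tail integral of the capacity gap. -/

noncomputable section

/-- The constant in front of the integral in the formula for the distribution function. -/
def msrConst (laml b c : ℝ) (i : ℕ) : ℝ :=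
  Real.log 2 * (Real.pi * laml) ^ i / ((Nat.factorial (i - 1) : ℝ) * b) * c ^ ((i : ℝ) / b)

end

section Tail

variable {laml lame b c : ℝ}

lemma msrConst_pos (hlaml : 0 < laml) (hb : 0 < b) (hc : 0 < c) (i : ℕ) :
    0 < msrConst laml b c i := by
  have hlog : 0 < Real.log 2 := Real.log_pos one_lt_two
  have := Real.pi_pos
  unfold msrConst
  positivity

lemma msrIntegrand_nonneg (laml lame b c : ℝ) (i : ℕ) {ϱ z : ℝ} (hz : 0 < z) :
    0 ≤ msrIntegrand laml lame b c i ϱ z := by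
  have := two_rpow_sub_one_pos hz
  unfold msrIntegrand
  positivity

lemma measurable_msrIntegrand (laml lame b c : ℝ) (i : ℕ) (ϱ : ℝ) :
    Measurable (msrIntegrand laml lame b c i ϱ) := by
  unfold msrIntegrand
  fun_prop

/-- The density of the capacity of the link to the `i`-th closest neighbour, weighted by the
probability that the eavesdropper is far enough. -/
lemma gammaPDFReal_sqLengthOfCapacity_mul_exp (hc : 0 < c) (hb : 0 < b)
    {i : ℕ} (hi : 1 ≤ i) {ϱ z : ℝ} (hz : 0 < z) :
    Real.log 2 / b * (2 : ℝ) ^ z / ((2 : ℝ) ^ z - 1) * sqLengthOfCapacity c b z *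
        gammaPDFReal i (Real.pi * laml) (sqLengthOfCapacity c b z) *
        Real.exp (-(Real.pi * lame * sqLengthOfCapacity c b (z - ϱ))) =
      msrConst laml b c i * msrIntegrand laml lame b c i ϱ z := by
  have h := two_rpow_sub_one_pos hz
  have hl := sqLengthOfCapacity_pos (b := b) hc hz
  obtain ⟨n, rfl⟩ : ∃ n, i = n + 1 := ⟨i - 1, by omega⟩
  -- The Jacobian contributes one factor of the squared length, raising the power `n` in the Erlang
  -- density to `n + 1 = i`. This is the source of `c ^ (i / b)` and of the exponent `1 + i / b`.
  have hpow : sqLengthOfCapacity c b z ^ (n + 1) =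
      c ^ (((n + 1 : ℕ) : ℝ) / b) / ((2 : ℝ) ^ z - 1) ^ (((n + 1 : ℕ) : ℝ) / b) := by
    rw [sqLengthOfCapacity, ← Real.rpow_natCast, ← Real.rpow_mul (div_pos hc h).le,
      ← Real.div_rpow hc.le h.le]
    congr 1
    ring
  have hexp : Real.exp (-(Real.pi * laml * (c / ((2 : ℝ) ^ z - 1)) ^ (1 / b))
      - Real.pi * lame * (c / ((2 : ℝ) ^ (z - ϱ) - 1)) ^ (1 / b)) =
      Real.exp (-(Real.pi * laml * sqLengthOfCapacity c b z)) *
        Real.exp (-(Real.pi * lame * sqLengthOfCapacity c b (z - ϱ))) := by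
    rw [← Real.exp_add, sub_eq_add_neg]
    rfl
  have hpdf : gammaPDFReal ((n + 1 : ℕ) : ℝ) (Real.pi * laml) (sqLengthOfCapacity c b z) =
      (Real.pi * laml) ^ (n + 1) / (Nat.factorial n : ℝ) * sqLengthOfCapacity c b z ^ n *
        Real.exp (-(Real.pi * laml * sqLengthOfCapacity c b z)) := by
    rw [gammaPDFReal, if_pos hl.le, Real.rpow_natCast]
    push_cast
    rw [Real.Gamma_nat_eq_factorial, add_sub_cancel_right, Real.rpow_natCast]
  rw [msrIntegrand, hexp, hpdf, msrConst, Nat.add_sub_cancel, Real.rpow_add h, Real.rpow_one]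
  have hc' := congrArg (· * ((2 : ℝ) ^ z - 1) ^ (((n + 1 : ℕ) : ℝ) / b)) hpow
  have hne : ((2 : ℝ) ^ z - 1) ^ (((n + 1 : ℕ) : ℝ) / b) ≠ 0 := (Real.rpow_pos_of_pos h _).ne'
  simp only [div_mul_cancel₀ _ hne] at hc'
  rw [← hc', pow_succ (sqLengthOfCapacity c b z)]
  have hf : (Nat.factorial n : ℝ) ≠ 0 := by positivity
  field_simp

/-- The probability, under independent Erlang and exponential squared distances, of any event
between `{ϱ < capacityGap}` and `{ϱ ≤ capacityGap}`. -/
lemma prod_gammaMeasure_expMeasure_eq_lintegral (hlame : 0 < lame)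
    (hc : 0 < c) (hb : 0 < b) {i : ℕ} (hi : 1 ≤ i) {ϱ : ℝ} (hϱ : 0 ≤ ϱ) {A : Set (ℝ × ℝ)}
    (hA : MeasurableSet A)
    (h1 : ∀ z, ϱ < z → ∀ y, sqLengthOfCapacity c b (z - ϱ) < y → (sqLengthOfCapacity c b z, y) ∈ A)
    (h2 : ∀ z, 0 < z → ∀ y, 0 < y → (sqLengthOfCapacity c b z, y) ∈ A →
      ϱ < z ∧ sqLengthOfCapacity c b (z - ϱ) ≤ y) :
    (gammaMeasure i (Real.pi * laml)).prod (expMeasure (Real.pi * lame)) A =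
      ∫⁻ z in Set.Ioi ϱ,
        ENNReal.ofReal (msrConst laml b c i * msrIntegrand laml lame b c i ϱ z) := by
  have hr : 0 < Real.pi * lame := mul_pos Real.pi_pos hlame
  have := isProbabilityMeasure_expMeasure hr
  rw [Measure.prod_apply hA,
    lintegral_gammaMeasure_eq_lintegral_sqLength hc hb (measurable_measure_prodMk_left hA),
    ← Set.Ioc_union_Ioi_eq_Ioi hϱ, lintegral_union measurableSet_Ioi Set.Ioc_disjoint_Ioi_same]
  -- If the legitimate capacity is at most `ϱ`, no positive `y` lies in the slice.
  have hleft : ∀ z ∈ Set.Ioc 0 ϱ,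
      expMeasure (Real.pi * lame) (Prod.mk (sqLengthOfCapacity c b z) ⁻¹' A) = 0 := by
    intro z hz
    refine measure_mono_null (fun y hy => ?_) (expMeasure_Iic_zero hr)
    by_contra hy0
    exact hz.2.not_gt (h2 z hz.1 y (not_le.1 hy0) hy).1
  rw [setLIntegral_congr_fun measurableSet_Ioc
    (g := fun _ => 0) fun z hz => by simp only [hleft z hz, mul_zero], lintegral_zero, zero_add]
  refine setLIntegral_congr_fun measurableSet_Ioi fun z (hz : ϱ < z) => ?_
  have hz0 : 0 < z := hϱ.trans_lt hz
  rw [expMeasure_eq_of_Ioi_subset (s := Prod.mk (sqLengthOfCapacity c b z) ⁻¹' A) hr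
      (sqLengthOfCapacity_pos hc (sub_pos.2 hz)).le
      (fun y hy => h1 z hz y hy) (fun y hy hy0 => (h2 z hz0 y hy0 hy).2),
    ← ENNReal.ofReal_mul' (Real.exp_pos _).le, gammaPDFReal_sqLengthOfCapacity_mul_exp hc hb hi hz0]

/-- No estimate of the integrand is needed: a positive multiple of it is nonnegative and its
integral is a probability. -/
lemma integrableOn_msrIntegrand (hlaml : 0 < laml) (hlame : 0 < lame) (hc : 0 < c) (hb : 0 < b)
    {i : ℕ} (hi : 1 ≤ i) {ϱ : ℝ} (hϱ : 0 ≤ ϱ) :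
    IntegrableOn (msrIntegrand laml lame b c i ϱ) (Set.Ioi ϱ) := by
  have hi0 : (0 : ℝ) < i := by exact_mod_cast hi
  have := isProbabilityMeasure_gammaMeasure hi0 (mul_pos Real.pi_pos hlaml)
  have := isProbabilityMeasure_expMeasure (mul_pos Real.pi_pos hlame)
  have hK := msrConst_pos hlaml hb hc i
  have hA : MeasurableSet {p : ℝ × ℝ | ϱ < capacityGap c b p.1 p.2} :=
    measurableSet_lt measurable_const (measurable_capacityGap c b)
  have h := prod_gammaMeasure_expMeasure_eq_lintegral (laml := laml) hlame hc hb hi hϱ hA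
    (fun z hz y hy => (lt_capacityGap_sqLengthOfCapacity_iff hc hb (hϱ.trans_lt hz)
      ((sqLengthOfCapacity_pos hc (sub_pos.2 hz)).trans hy)).2 ⟨hz, hy⟩)
    (fun z hz y hy hm => ((lt_capacityGap_sqLengthOfCapacity_iff hc hb hz hy).1 hm).imp id le_of_lt)
  have hint : IntegrableOn (fun z => msrConst laml b c i * msrIntegrand laml lame b c i ϱ z)
      (Set.Ioi ϱ) := by
    refine ⟨((measurable_msrIntegrand ..).const_mul _).aestronglyMeasurable, ?_⟩
    rw [hasFiniteIntegral_iff_ofReal, ← h]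
    · finiteness
    · filter_upwards [ae_restrict_mem measurableSet_Ioi] with z hz
      exact mul_nonneg hK.le (msrIntegrand_nonneg _ _ _ _ _ (hϱ.trans_lt hz))
  exact (integrable_const_mul_iff (IsUnit.mk0 _ hK.ne') _).1 hint

lemma prod_real_gammaMeasure_expMeasure_eq (hlaml : 0 < laml) (hlame : 0 < lame)
    (hc : 0 < c) (hb : 0 < b) {i : ℕ} (hi : 1 ≤ i) {ϱ : ℝ} (hϱ : 0 ≤ ϱ) {A : Set (ℝ × ℝ)}
    (hA : MeasurableSet A)
    (h1 : ∀ z, ϱ < z → ∀ y, sqLengthOfCapacity c b (z - ϱ) < y → (sqLengthOfCapacity c b z, y) ∈ A)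
    (h2 : ∀ z, 0 < z → ∀ y, 0 < y → (sqLengthOfCapacity c b z, y) ∈ A →
      ϱ < z ∧ sqLengthOfCapacity c b (z - ϱ) ≤ y) :
    ((gammaMeasure i (Real.pi * laml)).prod (expMeasure (Real.pi * lame))).real A =
      1 - msrCDFFormula laml lame b c i ϱ := by
  have hK := msrConst_pos hlaml hb hc i
  rw [measureReal_def, prod_gammaMeasure_expMeasure_eq_lintegral hlame hc hb hi hϱ hA h1 h2,
    ← integral_eq_lintegral_of_nonneg_ae, integral_const_mul, msrCDFFormula, sub_sub_cancel,
    msrConst]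
  · filter_upwards [ae_restrict_mem measurableSet_Ioi] with z hz
    exact mul_nonneg hK.le (msrIntegrand_nonneg _ _ _ _ _ (hϱ.trans_lt hz))
  · exact ((measurable_msrIntegrand ..).const_mul _).aestronglyMeasurable

/-- The positive gap event has the probability that an Erlang variable is less than an independent
exponential one. -/
lemma prod_real_capacityGap_pos (hlaml : 0 < laml) (hlame : 0 < lame)
    (hc : 0 < c) (hb : 0 < b) {i : ℕ} (hi : 1 ≤ i) :
    ((gammaMeasure i (Real.pi * laml)).prod (expMeasure (Real.pi * lame))).real
      {p | 0 < capacityGap c b p.1 p.2} = (laml / (laml + lame)) ^ i := by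
  have hi0 : (0 : ℝ) < i := by exact_mod_cast hi
  have hα : 0 < Real.pi * laml := mul_pos Real.pi_pos hlaml
  have hβ : 0 < Real.pi * lame := mul_pos Real.pi_pos hlame
  have := isProbabilityMeasure_expMeasure hβ
  have hA : MeasurableSet {p : ℝ × ℝ | 0 < capacityGap c b p.1 p.2} :=
    measurableSet_lt measurable_const (measurable_capacityGap c b)
  have hpdf (r : ℝ) : Measurable (gammaPDF i r) := (measurable_gammaPDFReal i r).ennreal_ofReal
  have hslice {x : ℝ} (hx : 0 < x) : expMeasure (Real.pi * lame)
      (Prod.mk x ⁻¹' {p : ℝ × ℝ | 0 < capacityGap c b p.1 p.2}) =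
        ENNReal.ofReal (Real.exp (-(Real.pi * lame * x))) := by
    obtain ⟨z, hz, rfl⟩ := exists_sqLengthOfCapacity_eq hc hb hx
    refine expMeasure_eq_of_Ioi_subset hβ hx.le (fun y hy => ?_) (fun y hy hy0 => ?_)
    · exact (lt_capacityGap_sqLengthOfCapacity_iff hc hb hz (hx.trans hy)).2
        ⟨hz, by rwa [sub_zero]⟩
    · have h := ((lt_capacityGap_sqLengthOfCapacity_iff hc hb hz hy0).1 hy).2
      rw [sub_zero] at h
      exact h.le
  have hratio : 0 ≤ (laml / (laml + lame)) ^ i := by positivity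
  rw [measureReal_def, Measure.prod_apply hA, gammaMeasure,
    lintegral_withDensity_eq_lintegral_mul _ (hpdf _) (measurable_measure_prodMk_left hA)]
  -- Multiplying the Erlang density by the exponential tail adds the rates; up to the ratio of
  -- normalizing constants, the product is again an Erlang density of order `i`, with total mass 1.
  have hae : ∀ᵐ x : ℝ, (gammaPDF i (Real.pi * laml) * fun x => expMeasure (Real.pi * lame)
      (Prod.mk x ⁻¹' {p : ℝ × ℝ | 0 < capacityGap c b p.1 p.2})) x =
      ENNReal.ofReal ((laml / (laml + lame)) ^ i) *
        gammaPDF i (Real.pi * laml + Real.pi * lame) x := by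
    filter_upwards [Measure.ae_ne volume (0 : ℝ)] with x hx
    rcases lt_or_gt_of_ne hx with hx | hx
    · simp [gammaPDF_of_neg hx]
    rw [Pi.mul_apply, hslice hx, gammaPDF_of_nonneg hx.le, gammaPDF_of_nonneg hx.le,
      ← ENNReal.ofReal_mul' (Real.exp_pos _).le, ← ENNReal.ofReal_mul hratio]
    congr 1
    have hexp : Real.exp (-((Real.pi * laml + Real.pi * lame) * x)) =
        Real.exp (-(Real.pi * laml * x)) * Real.exp (-(Real.pi * lame * x)) := by
      rw [← Real.exp_add]
      congr 1
      ring
    rw [hexp, Real.rpow_natCast, Real.rpow_natCast, ← mul_add, mul_pow, mul_pow, div_pow]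
    have : (laml + lame) ^ i ≠ 0 := by positivity
    field_simp
  rw [lintegral_congr_ae hae, lintegral_const_mul _ (hpdf _),
    lintegral_gammaPDF_eq_one hi0 (by positivity), mul_one, ENNReal.toReal_ofReal hratio]

end Tail

/-! ### The secrecy rate and its distribution. -/

lemma neighbourMSR_pathGain_eq {d : ℕ} (b P σ : ℝ) (L E : Set (EuclideanSpace ℝ (Fin d)))
    (x : EuclideanSpace ℝ (Fin d)) (i : ℕ) :
    neighbourMSR (pathGain b) P σ L E x i =
      max (capacityGap (P / σ ^ 2) b (neighbourDist L x i ^ 2) (Metric.infDist x E ^ 2)) 0 := by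
  have h {r : ℝ} (hr : 0 ≤ r) : P * pathGain b r / σ ^ 2 = P / σ ^ 2 * (r ^ 2) ^ (-b) := by
    rw [pathGain, ← Real.rpow_natCast_mul hr]
    push_cast
    rw [mul_neg]
    ring
  have hL : 0 ≤ neighbourDist L x i := Real.sInf_nonneg fun r hr => hr.1
  rw [neighbourMSR, maxSecrecyRate, capacityGap, h hL, h Metric.infDist_nonneg]

theorem mainTheorem9 {Ω : Type*} [MeasurableSpace Ω] (μ : Measure Ω) [IsProbabilityMeasure μ]
    (laml lame b P σ : ℝ) (hlaml : 0 < laml) (hlame : 0 < lame) (hb : 0 < b) (hP : 0 < P)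
    (hσ : 0 < σ)
    (Pil Pie : Ω → Set (EuclideanSpace ℝ (Fin 2)))
    (hPil : IsHomogeneousPoissonProcess Pil laml μ)
    (hPie : IsHomogeneousPoissonProcess Pie lame μ)
    (hindep : IndepProcesses Pil Pie μ)
    (i : ℕ) (hi : 1 ≤ i)
    (Rs : Ω → ℝ)
    (hRs : Rs = fun ω => neighbourMSR (pathGain b) P σ (insert 0 (Pil ω)) (Pie ω) 0 i) :
    Measurable Rs ∧
    HasLaw (fun ω => neighbourDist (insert 0 (Pil ω)) 0 i ^ 2)
      (gammaMeasure i (Real.pi * laml)) μ ∧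
    HasLaw (fun ω => Metric.infDist 0 (Pie ω) ^ 2) (expMeasure (Real.pi * lame)) μ ∧
    (∀ ϱ : ℝ, 0 ≤ ϱ →
      IntegrableOn (msrIntegrand laml lame b (P / σ ^ 2) i ϱ) (Set.Ioi ϱ) ∧
      cdf (μ.map Rs) ϱ = msrCDFFormula laml lame b (P / σ ^ 2) i ϱ) ∧
    μ.real {ω | 0 < Rs ω} = (laml / (laml + lame)) ^ i ∧
    (∀ ϱ : ℝ, 0 < ϱ → μ.real {ω | Rs ω < ϱ} = msrCDFFormula laml lame b (P / σ ^ 2) i ϱ) := by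
  have hc : 0 < P / σ ^ 2 := by positivity
  set c := P / σ ^ 2 with hcdef
  set X : Ω → ℝ := fun ω => neighbourDist (insert 0 (Pil ω)) 0 i ^ 2 with hX
  set Y : Ω → ℝ := fun ω => Metric.infDist 0 (Pie ω) ^ 2 with hY
  have hXm' : Measurable[processSigma Pil] X :=
    (measurable_neighbourDist_processSigma hPil.locallyFinite 0 i).pow_const 2
  have hYm' : Measurable[processSigma Pie] Y :=
    (measurable_infDist_processSigma hPie.locallyFinite 0).pow_const 2
  have hXm : Measurable X := hXm'.mono hPil.toIsPointProcess.processSigma_le le_rfl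
  have hYm : Measurable Y := hYm'.mono hPie.toIsPointProcess.processSigma_le le_rfl
  have hXlaw := hPil.hasLaw_neighbourDist_sq hlaml 0 hi
  have hYlaw := hPie.hasLaw_infDist_sq hlame 0
  have hXY : IndepFun X Y μ :=
    indep_of_indep_of_le_right (indep_of_indep_of_le_left hindep hXm'.comap_le) hYm'.comap_le
  have hjoint : μ.map (fun ω => (X ω, Y ω)) =
      (gammaMeasure i (Real.pi * laml)).prod (expMeasure (Real.pi * lame)) := by
    rw [(indepFun_iff_map_prod_eq_prod_map_map hXm.aemeasurable hYm.aemeasurable).1 hXY,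
      hXlaw.map_eq, hYlaw.map_eq]
  have hprob {A : Set (ℝ × ℝ)} (hA : MeasurableSet A) : μ.real {ω | (X ω, Y ω) ∈ A} =
      ((gammaMeasure i (Real.pi * laml)).prod (expMeasure (Real.pi * lame))).real A := by
    rw [← hjoint, map_measureReal_apply (hXm.prodMk hYm) hA]
    rfl
  have hRs' : Rs = fun ω => max (capacityGap c b (X ω) (Y ω)) 0 := by
    rw [hRs]
    exact funext fun ω => neighbourMSR_pathGain_eq ..
  have hRsm : Measurable Rs := by
    rw [hRs']
    exact ((measurable_capacityGap c b).comp (hXm.prodMk hYm)).max measurable_const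
  have hlt (ϱ : ℝ) : MeasurableSet {p : ℝ × ℝ | ϱ < capacityGap c b p.1 p.2} :=
    measurableSet_lt measurable_const (measurable_capacityGap c b)
  have hle (ϱ : ℝ) : MeasurableSet {p : ℝ × ℝ | ϱ ≤ capacityGap c b p.1 p.2} :=
    measurableSet_le measurable_const (measurable_capacityGap c b)
  have hltRs {ϱ : ℝ} (hϱ : 0 ≤ ϱ) (ω : Ω) : ϱ < Rs ω ↔ ϱ < capacityGap c b (X ω) (Y ω) := by
    rw [hRs', lt_max_iff, or_iff_left hϱ.not_gt]
  -- Strict positivity is essential: `0 ≤ Rs ω` always holds because of the clipping, whatever the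
  -- sign of the gap.
  have hleRs {ϱ : ℝ} (hϱ : 0 < ϱ) (ω : Ω) : ϱ ≤ Rs ω ↔ ϱ ≤ capacityGap c b (X ω) (Y ω) := by
    rw [hRs', le_max_iff, or_iff_left hϱ.not_ge]
  refine ⟨hRsm, hXlaw, hYlaw, fun ϱ hϱ => ⟨integrableOn_msrIntegrand hlaml hlame hc hb hi hϱ, ?_⟩,
    ?_, fun ϱ hϱ => ?_⟩
  · have := Measure.isProbabilityMeasure_map (μ := μ) hRsm.aemeasurable
    have h := prod_real_gammaMeasure_expMeasure_eq hlaml hlame hc hb hi hϱ (hlt ϱ)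
      (fun z hz y hy => (lt_capacityGap_sqLengthOfCapacity_iff hc hb (hϱ.trans_lt hz)
        ((sqLengthOfCapacity_pos hc (sub_pos.2 hz)).trans hy)).2 ⟨hz, hy⟩)
      (fun z hz y hy hm =>
        ((lt_capacityGap_sqLengthOfCapacity_iff hc hb hz hy).1 hm).imp id le_of_lt)
    rw [← hprob (hlt ϱ)] at h
    have hset : {ω | (X ω, Y ω) ∈ {p : ℝ × ℝ | ϱ < capacityGap c b p.1 p.2}} =
        (Rs ⁻¹' Set.Iic ϱ)ᶜ := by
      ext ω
      exact (hltRs hϱ ω).symm.trans not_le.symm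
    rw [hset, probReal_compl_eq_one_sub (hRsm measurableSet_Iic)] at h
    rw [cdf_eq_real, map_measureReal_apply hRsm measurableSet_Iic]
    linarith
  · rw [← prod_real_capacityGap_pos hlaml hlame hc hb hi, ← hprob (hlt 0)]
    congr 1
    ext ω
    exact hltRs le_rfl ω
  · have h := prod_real_gammaMeasure_expMeasure_eq hlaml hlame hc hb hi hϱ.le (hle ϱ)
      (fun z hz y hy => (le_capacityGap_sqLengthOfCapacity_iff hc hb (hϱ.trans hz)
        ((sqLengthOfCapacity_pos hc (sub_pos.2 hz)).trans hy)).2 ⟨hz, hy.le⟩)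
      (fun z hz y hy hm => (le_capacityGap_sqLengthOfCapacity_iff hc hb hz hy).1 hm)
    rw [← hprob (hle ϱ)] at h
    have hset : {ω | (X ω, Y ω) ∈ {p : ℝ × ℝ | ϱ ≤ capacityGap c b p.1 p.2}} =
        (Rs ⁻¹' Set.Iio ϱ)ᶜ := by
      ext ω
      exact (hleRs hϱ ω).symm.trans not_lt.symm
    rw [hset, probReal_compl_eq_one_sub (hRsm measurableSet_Iio)] at h
    change μ.real (Rs ⁻¹' Set.Iio ϱ) = _
    linarith
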